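/- Let $H=(V,E)$ be a $3$-uniform hypergraph on $n\ge 10$ vertices, i.e. $V$ is a set with $|V|=n$ and $E$ is a set of $3$-element subsets of $V$. A \emph{linear cycle} of length $k\ge 3$ in $H$ is an alternating sequence $v_1,h_1,v_2,h_2,\dots,v_k,h_k$ of distinct vertices $v_i\in V$ and distinct hyperedges $h_i\in E$ such that $h_i\cap h_{i+1}=\{v_{i+1}\}$ for each $1\le i\le k-1$, $h_1\cap h_k=\{v_1\}$, and $h_i\cap h_j=\emptyset$ whenever $1<|j-i|<k-1$. If $H$ contains no linear cycle (of any length $k\ge 3$), then there is a vertex of $H$ whose degree, i.e. the number of hyperedges containing it, is at most $n-2$. -/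

import Mathlib

open scoped Hypergraph

namespace Hypergraph

/-- A hypergraph is `3`-uniform if every hyperedge has exactly three elements. -/
def IsThreeUniform {α : Type*} (H : Hypergraph α) : Prop :=
  ∀ e ∈ E(H), e.ncard = 3

/-- The degree of a vertex `x`: the number of hyperedges that contain `x`
(meaningful when only finitely many hyperedges contain `x`). -/
noncomputable def degree {α : Type*} (H : Hypergraph α) (x : α) : ℕ :=
  {e | e ∈ E(H) ∧ x ∈ e}.ncard

/-- `v 0, h 0, v 1, h 1, …, v (k - 1), h (k - 1)` is a linear cycle of length `k ≥ 3` in `H`: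
the `v i` are distinct vertices, the `h i` are distinct hyperedges, consecutive hyperedges
`h i`, `h (i + 1)` meet exactly in `v (i + 1)`, the first and the last one meet exactly in `v 0`,
and `h i`, `h j` are disjoint whenever `1 < |j - i| < k - 1`. -/
structure IsLinearCycle {α : Type*} (H : Hypergraph α) (k : ℕ)
    (v : Fin k → α) (h : Fin k → Set α) : Prop where
  three_le : 3 ≤ k
  vertex_mem : ∀ i, v i ∈ V(H)
  edge_mem : ∀ i, h i ∈ E(H)
  vertex_injective : Function.Injective v
  edge_injective : Function.Injective h
  inter_succ : ∀ i j : Fin k, (j : ℕ) = (i : ℕ) + 1 → h i ∩ h j = {v j}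
  inter_last : ∀ i j : Fin k, (i : ℕ) = 0 → (j : ℕ) + 1 = k → h i ∩ h j = {v i}
  disjoint : ∀ i j : Fin k, (i : ℕ) + 1 < (j : ℕ) → (j : ℕ) + 1 < (i : ℕ) + k →
    h i ∩ h j = ∅

/-- A hypergraph without linear cycles (of any length `k ≥ 3`). -/
def IsLinearCycleFree {α : Type*} (H : Hypergraph α) : Prop :=
  ∀ (k : ℕ) (v : Fin k → α) (h : Fin k → Set α), ¬ H.IsLinearCycle k v h

end Hypergraph

namespace Hypergraph

/-! Suppose every degree is at least `n - 1`. Take a longest linear path, with first hyperedge `{a,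
b, u 0}` and remaining path `u` of `k` hyperedges. Maximality and the absence of linear cycles force
every hyperedge through `a` that misses `b` and `u 0` to be far: `a` with `u (2 * i + 1)` and `u (2
* i + 2)` (`IsEnd.isFar`). A far hyperedge in turn blocks `{a, u 0, u m}` and `{a, b, u m}` for
later `m`. So the hyperedges at `a` and at `b` can be counted with almost no slack.

Counting shows that `b` is the only vertex off the path completing `{a, u 0}`
(`IsEnd.eq_of_mem_outSet`), and then that either `{a, b}` forms a hyperedge with every other vertex
or `{a, u 0, u 1}` is a hyperedge (`IsEnd.dichotomy`). Comparing both ends of the path excludes the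
latter (`IsEnd.triple_of_mem`). In particular `{a, b, u (2 * k)}` is a hyperedge, so `u` may be
reversed behind `{a, b}`; now `{a, b}`, `{u (2 * k), u (2 * k - 1)}` and `{u 0, u 1}` are all end
pairs, and they close into a triangle (`IsEnd.false`). -/

/-! ### Counting sets of indices -/

theorem ncard_le_of_subset_Icc {S : Set ℕ} {p q : ℕ} (h : S ⊆ Set.Icc p q) :
    S.ncard ≤ q + 1 - p := by
  refine (Set.ncard_le_ncard h (Set.finite_Icc p q)).trans ?_
  rw [← Finset.coe_Icc, Set.ncard_coe_finset, Nat.card_Icc]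

theorem eq_Icc_of_le_ncard {S : Set ℕ} {p q : ℕ} (h : S ⊆ Set.Icc p q)
    (hc : q + 1 - p ≤ S.ncard) : S = Set.Icc p q := by
  refine Set.eq_of_subset_of_ncard_le h ?_ (Set.finite_Icc p q)
  rwa [← Finset.coe_Icc, Set.ncard_coe_finset, Nat.card_Icc]

theorem ncard_le_of_subset_Iio {I : Set ℕ} {p q : ℕ} (h : ∀ i ∈ I, p ≤ i ∧ i < q) :
    I.ncard ≤ q - p := by
  rcases Nat.eq_zero_or_pos q with rfl | hq
  · have : I = ∅ := Set.eq_empty_of_forall_notMem fun i hi => by have := h i hi; omega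
    simp [this]
  · have : I ⊆ Set.Icc p (q - 1) := fun i hi => by
      have := h i hi
      simp only [Set.mem_Icc]
      omega
    have := ncard_le_of_subset_Icc this
    omega

theorem exists_least_of_cut {k : ℕ} {S I : Set ℕ} (hS : S ⊆ Set.Icc 1 (2 * k))
    (hI : I ⊆ Set.Iio k) (h : ∀ i ∈ I, ∀ m ∈ S, m ≤ 2 * i + 2) :
    I = ∅ ∨ ∃ i ∈ I, i < k ∧ S ⊆ Set.Icc 1 (2 * i + 2) ∧ ∀ j ∈ I, i ≤ j := by
  rcases I.eq_empty_or_nonempty with h0 | h0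
  · exact Or.inl h0
  · refine Or.inr ⟨sInf I, Nat.sInf_mem h0, hI (Nat.sInf_mem h0), fun m hm => ?_, ?_⟩
    · exact ⟨(hS hm).1, h _ (Nat.sInf_mem h0) m hm⟩
    · exact fun i hi => Nat.sInf_le hi

/-- The least `i ∈ I` leaves at most `2 * i + 2` values for `S` and `k - i` for `I`, in total `k + i
+ 2`; exceeding `2 * k` requires `i = k - 1`. -/
theorem ncard_add_ncard_le_of_cut {k : ℕ} {S I : Set ℕ} (hS : S ⊆ Set.Icc 1 (2 * k))
    (hI : I ⊆ Set.Iio k) (h : ∀ i ∈ I, ∀ m ∈ S, m ≤ 2 * i + 2) :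
    S.ncard + I.ncard ≤ 2 * k ∨
      S.ncard + I.ncard = 2 * k + 1 ∧ 1 ≤ k ∧ k - 1 ∈ I ∧ S = Set.Icc 1 (2 * k) := by
  rcases exists_least_of_cut hS hI h with rfl | ⟨i, hi, hik, hSi, hIi⟩
  · have := ncard_le_of_subset_Icc hS
    simp
    omega
  · have := ncard_le_of_subset_Icc hSi
    have := ncard_le_of_subset_Iio fun j hj => ⟨hIi j hj, hI hj⟩
    by_cases hc : S.ncard + I.ncard ≤ 2 * k
    · exact Or.inl hc
    · obtain rfl : i = k - 1 := by omega
      exact Or.inr ⟨by omega, by omega, hi, eq_Icc_of_le_ncard hS (by omega)⟩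

theorem ncard_add_two_mul_ncard_le {k : ℕ} {S I : Set ℕ} (hS : S ⊆ Set.Icc 1 (2 * k))
    (hI : I ⊆ Set.Iio k) (h : ∀ i ∈ I, 2 * i + 1 ∉ S ∧ 2 * i + 2 ∉ S) :
    S.ncard + 2 * I.ncard ≤ 2 * k := by
  have hSf : S.Finite := (Set.finite_Icc _ _).subset hS
  have hIf : I.Finite := (Set.finite_Iio _).subset hI
  have h1 : ((fun i => 2 * i + 1) '' I).ncard = I.ncard :=
    Set.ncard_image_of_injective _ fun a b hab => by simpa using hab
  have h2 : ((fun i => 2 * i + 2) '' I).ncard = I.ncard :=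
    Set.ncard_image_of_injective _ fun a b hab => by simpa using hab
  have hd1 : Disjoint S ((fun i => 2 * i + 1) '' I) := by
    rw [Set.disjoint_right]
    rintro _ ⟨i, hi, rfl⟩
    exact (h i hi).1
  have hd2 : Disjoint (S ∪ (fun i => 2 * i + 1) '' I) ((fun i => 2 * i + 2) '' I) := by
    rw [Set.disjoint_right]
    rintro _ ⟨i, hi, rfl⟩ (hc | ⟨j, -, hj⟩)
    · exact (h i hi).2 hc
    · simp only at hj
      omega
  have hsub : S ∪ (fun i => 2 * i + 1) '' I ∪ (fun i => 2 * i + 2) '' I ⊆ Set.Icc 1 (2 * k) := by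
    rintro m ((hm | ⟨i, hi, rfl⟩) | ⟨i, hi, rfl⟩)
    · exact hS hm
    · have := hI hi
      simp only [Set.mem_Iio, Set.mem_Icc] at *
      omega
    · have := hI hi
      simp only [Set.mem_Iio, Set.mem_Icc] at *
      omega
  have := ncard_le_of_subset_Icc hsub
  rw [Set.ncard_union_eq hd2 (hSf.union (hIf.image _)) (hIf.image _),
    Set.ncard_union_eq hd1 hSf (hIf.image _)] at this
  omega

/-! ### Linear paths and ways to close them into linear cycles -/

variable {α : Type*} {H : Hypergraph α}

/-- The triple `x, y, z` forms a hyperedge. -/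
def Triple (H : Hypergraph α) (x y z : α) : Prop := ({x, y, z} : Set α) ∈ E(H)

theorem Triple.swap {x y z : α} (h : H.Triple x y z) : H.Triple y x z := by
  unfold Triple at *
  rwa [Set.insert_comm]

theorem Triple.rot {x y z : α} (h : H.Triple x y z) : H.Triple y z x := by
  unfold Triple at *
  convert h using 1
  ext t
  simp
  tauto

theorem Triple.rot' {x y z : α} (h : H.Triple x y z) : H.Triple z x y := h.rot.rot

theorem Triple.swap' {x y z : α} (h : H.Triple x y z) : H.Triple x z y := h.swap.rot

theorem Triple.rev {x y z : α} (h : H.Triple x y z) : H.Triple z y x := h.rot.swap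

theorem Triple.mem {x y z : α} (h : H.Triple x y z) : x ∈ V(H) :=
  mem_vertexSet_of_mem_edgeSet h (by simp)

theorem Triple.ne {x y z : α} (h : H.Triple x y z) (hu : H.IsThreeUniform) : x ≠ y := by
  rintro rfl
  have h3 := hu _ h
  rw [Set.insert_eq_of_mem (by simp)] at h3
  have := Set.ncard_insert_le x {z}
  rw [Set.ncard_singleton] at this
  omega

theorem Triple.ne' {x y z : α} (h : H.Triple x y z) (hu : H.IsThreeUniform) : x ≠ z :=
  h.swap'.ne hu

/-- The vertices of a linear cycle of length `K`, listed along the cycle as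
`w 0, …, w (2 * K - 1)`; the hyperedges start at the even positions. -/
theorem IsLinearCycleFree.false_of_cycle (hf : H.IsLinearCycleFree) {K : ℕ} (hK : 3 ≤ K)
    (w : ℕ → α) (hw : Set.InjOn w (Set.Iio (2 * K)))
    (he : ∀ i, i + 1 < K → H.Triple (w (2 * i)) (w (2 * i + 1)) (w (2 * i + 2)))
    (hlast : H.Triple (w (2 * K - 2)) (w (2 * K - 1)) (w 0)) : False := by
  -- The last hyperedge wraps round to index `0`. As `w` is injective, intersections of hyperedges
  -- reduce to those of index sets.
  let I : Fin K → Set ℕ := fun i => {2 * (i : ℕ), 2 * (i : ℕ) + 1, if (i : ℕ) + 1 < K then 2 * (i : ℕ) + 2 else 0}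
  have hI : ∀ i, I i ⊆ Set.Iio (2 * K) := by
    intro i x hx
    have := i.2
    simp only [I, Set.mem_insert_iff, Set.mem_singleton_iff] at hx
    simp only [Set.mem_Iio]
    split_ifs at hx <;> omega
  have hinter : ∀ i j, w '' I i ∩ w '' I j = w '' (I i ∩ I j) := fun i j =>
    (hw.image_inter (hI i) (hI j)).symm
  have hmemE : ∀ i, w '' I i ∈ E(H) := by
    intro i
    have hi := i.2
    simp only [I, Set.image_insert_eq, Set.image_singleton]
    split_ifs with h
    · exact he i h
    · have : (i : ℕ) = K - 1 := by omega
      rw [this, show 2 * (K - 1) = 2 * K - 2 by omega, show 2 * K - 2 + 1 = 2 * K - 1 by omega]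
      exact hlast
  have hsucc : ∀ i j : Fin K, (j : ℕ) = (i : ℕ) + 1 → I i ∩ I j = {2 * (j : ℕ)} := by
    intro i j hij
    have := j.2
    ext x
    simp only [I, Set.mem_inter_iff, Set.mem_insert_iff, Set.mem_singleton_iff]
    split_ifs <;> omega
  have hlst : ∀ i j : Fin K, (i : ℕ) = 0 → (j : ℕ) + 1 = K → I i ∩ I j = {2 * (i : ℕ)} := by
    intro i j hi hj
    ext x
    simp only [I, Set.mem_inter_iff, Set.mem_insert_iff, Set.mem_singleton_iff]
    split_ifs <;> omega
  have hdis : ∀ i j : Fin K, (i : ℕ) + 1 < (j : ℕ) → (j : ℕ) + 1 < (i : ℕ) + K → I i ∩ I j = ∅ := by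
    intro i j hi hj
    have := j.2
    rw [Set.eq_empty_iff_forall_notMem]
    rintro x ⟨h1, h2⟩
    simp only [I, Set.mem_insert_iff, Set.mem_singleton_iff] at h1 h2
    split_ifs at h1 h2 <;> omega
  refine hf K (fun i => w (2 * (i : ℕ))) (fun i => w '' I i) ⟨hK, ?_, hmemE, ?_, ?_, ?_, ?_, ?_⟩
  · intro i
    exact mem_vertexSet_of_mem_edgeSet (hmemE i) ⟨2 * (i : ℕ), by simp [I], rfl⟩
  · intro i j hij
    have hi := i.2
    have hj := j.2
    have : 2 * (i : ℕ) = 2 * (j : ℕ) := hw (by simp) (by simp) hij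
    ext
    omega
  · intro i j hij
    have h2 : I i = I j := (hw.image_eq_image_iff (hI i) (hI j)).1 hij
    have hi := i.2
    have hj := j.2
    -- Each index set has a single odd element, which identifies the hyperedge.
    have hx : 2 * (i : ℕ) + 1 ∈ I j := by rw [← h2]; simp [I]
    simp only [I, Set.mem_insert_iff, Set.mem_singleton_iff] at hx
    have hx' : (if (j : ℕ) + 1 < K then 2 * (j : ℕ) + 2 else 0) % 2 = 0 := by
      split_ifs <;> omega
    ext
    omega
  · intro i j hij
    simp only [hinter, hsucc i j hij, Set.image_singleton]
  · intro i j hi hj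
    simp only [hinter, hlst i j hi hj, Set.image_singleton]
  · intro i j hi hj
    simp only [hinter, hdis i j hi hj, Set.image_empty]

theorem IsLinearCycleFree.false_of_triangle (hf : H.IsLinearCycleFree) (hu : H.IsThreeUniform)
    {x a y b z c : α} (h1 : H.Triple x a y) (h2 : H.Triple y b z) (h3 : H.Triple z c x)
    (hab : a ≠ b) (hac : a ≠ c) (hbc : b ≠ c) (haz : a ≠ z) (hbx : b ≠ x) (hcy : c ≠ y) :
    False := by
  have hxy := h1.ne' hu
  have hyz := h2.ne' hu
  have hzx := h3.ne' hu
  have hxa := h1.ne hu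
  have hya := h1.rot.rot.swap'.ne hu
  have hyb := h2.ne hu
  have hzc := h3.ne hu
  have hby := h1.rot.ne hu
  have hbz := h2.rot.ne hu
  have hcx := h3.rot.ne hu
  refine hf.false_of_cycle (K := 3) le_rfl
    (fun m => if m = 0 then x else if m = 1 then a else if m = 2 then y else
      if m = 3 then b else if m = 4 then z else c) ?_ ?_ ?_
  · intro i hi j hj hij
    simp only [Set.mem_Iio] at hi hj
    interval_cases i <;> interval_cases j <;> simp_all
  · intro i hi
    have : i = 0 ∨ i = 1 := by omega
    rcases this with rfl | rfl <;> simpa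
  · simpa

/-- `u 0, …, u (2 * k)` are the vertices of a linear path with `k` hyperedges
`{u (2 * i), u (2 * i + 1), u (2 * i + 2)}`. -/
structure IsLoosePath (H : Hypergraph α) (u : ℕ → α) (k : ℕ) : Prop where
  inj : ∀ i j, i ≤ 2 * k → j ≤ 2 * k → u i = u j → i = j
  edge : ∀ i, i < k → H.Triple (u (2 * i)) (u (2 * i + 1)) (u (2 * i + 2))

theorem IsLoosePath.segment {u : ℕ → α} {k : ℕ} (hP : H.IsLoosePath u k) {i j : ℕ}
    (hij : i + j ≤ k) : H.IsLoosePath (fun m => u (2 * i + m)) j where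
  inj a b ha hb h := by
    have := hP.inj _ _ (by omega) (by omega) h
    omega
  edge a ha := by
    have := hP.edge (i + a) (by omega)
    convert this using 2 <;> ring

theorem IsLoosePath.swap_first {u : ℕ → α} {k : ℕ} (hk : 1 ≤ k) (hP : H.IsLoosePath u k) :
    H.IsLoosePath (u ∘ Equiv.swap 0 1) k where
  inj a b ha hb h := by
    have hlt : ∀ a, a ≤ 2 * k → Equiv.swap 0 1 a ≤ 2 * k := by
      intro a ha
      rw [Equiv.swap_apply_def]
      split_ifs <;> omega
    exact (Equiv.swap 0 1).injective (hP.inj _ _ (hlt a ha) (hlt b hb) h)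
  edge a ha := by
    have := hP.edge a ha
    rcases Nat.eq_zero_or_pos a with rfl | h0
    · simpa [Equiv.swap_apply_of_ne_of_ne] using this.swap
    · simp only [Function.comp]
      rwa [Equiv.swap_apply_of_ne_of_ne (by omega) (by omega),
        Equiv.swap_apply_of_ne_of_ne (by omega) (by omega),
        Equiv.swap_apply_of_ne_of_ne (by omega) (by omega)]

theorem IsLoosePath.swap_last {u : ℕ → α} {k : ℕ} (hk : 1 ≤ k) (hP : H.IsLoosePath u k) :
    H.IsLoosePath (u ∘ Equiv.swap (2 * k - 1) (2 * k)) k where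
  inj a b ha hb h := by
    have hlt : ∀ a, a ≤ 2 * k → Equiv.swap (2 * k - 1) (2 * k) a ≤ 2 * k := by
      intro a ha
      rw [Equiv.swap_apply_def]
      split_ifs <;> omega
    exact (Equiv.swap _ _).injective (hP.inj _ _ (hlt a ha) (hlt b hb) h)
  edge a ha := by
    have := hP.edge a ha
    simp only [Function.comp]
    rcases eq_or_ne (a + 1) k with rfl | h0
    · rw [Equiv.swap_apply_of_ne_of_ne (by omega) (by omega)]
      have e1 : 2 * (a + 1) - 1 = 2 * a + 1 := by omega
      have e2 : 2 * (a + 1) = 2 * a + 2 := by omega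
      rw [e1, e2, Equiv.swap_apply_left, Equiv.swap_apply_right]
      exact this.swap'
    · rwa [Equiv.swap_apply_of_ne_of_ne (by omega) (by omega),
        Equiv.swap_apply_of_ne_of_ne (by omega) (by omega),
        Equiv.swap_apply_of_ne_of_ne (by omega) (by omega)]

theorem IsLoosePath.reverse {u : ℕ → α} {k : ℕ} (hP : H.IsLoosePath u k) :
    H.IsLoosePath (fun m => u (2 * k - m)) k where
  inj a b ha hb h := by
    have := hP.inj _ _ (by omega) (by omega) h
    omega
  edge a ha := by
    have := (hP.edge (k - 1 - a) (by omega)).rev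
    convert this using 2 <;> omega

theorem IsLoosePath.cons {u : ℕ → α} {k : ℕ} (hu : H.IsThreeUniform) (hP : H.IsLoosePath u k)
    {x y : α} (h : H.Triple x y (u 0)) (hx : ∀ m ≤ 2 * k, u m ≠ x) (hy : ∀ m ≤ 2 * k, u m ≠ y) :
    H.IsLoosePath (fun m => if m = 0 then x else if m = 1 then y else u (m - 2)) (k + 1) where
  inj a b ha hb hab := by
    have hxy := h.ne hu
    have key : ∀ m, m ≤ 2 * (k + 1) → m ≠ 0 → m ≠ 1 → u (m - 2) ≠ x ∧ u (m - 2) ≠ y :=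
      fun m h1 h2 h3 => ⟨hx _ (by omega), hy _ (by omega)⟩
    have ka := key a ha
    have kb := key b hb
    have hinj := hP.inj (a - 2) (b - 2)
    split_ifs at hab <;> grind
  edge a ha := by
    rcases Nat.eq_zero_or_pos a with rfl | h0
    · simpa using h
    · have := hP.edge (a - 1) (by omega)
      have e : 2 * a - 2 = 2 * (a - 1) := by omega
      have e' : 2 * a + 1 - 2 = 2 * (a - 1) + 1 := by omega
      have e'' : 2 * a + 2 - 2 = 2 * (a - 1) + 2 := by omega
      rw [if_neg (by omega), if_neg (by omega), if_neg (by omega), if_neg (by omega),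
        if_neg (by omega), if_neg (by omega), e, e', e'']
      exact this

theorem IsLoosePath.false_of_closed {u : ℕ → α} {k : ℕ} (hu : H.IsThreeUniform)
    (hf : H.IsLinearCycleFree) (hP : H.IsLoosePath u k) (hk : 1 ≤ k) {a x y : α}
    (h1 : H.Triple a y (u (2 * k))) (h2 : H.Triple a x (u 0)) (hxy : x ≠ y)
    (hs : ∀ m ≤ 2 * k, u m ≠ a ∧ u m ≠ x ∧ u m ≠ y) : False := by
  have hax := h2.ne hu
  have hay := h1.ne hu
  refine hf.false_of_cycle (K := k + 2) (by omega)
    (fun m => if m ≤ 2 * k then u m else if m = 2 * k + 1 then y else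
      if m = 2 * k + 2 then a else x) ?_ ?_ ?_
  · intro i hi j hj hij
    simp only [Set.mem_Iio] at hi hj
    have ki := hs i
    have kj := hs j
    have hinj := hP.inj i j
    beta_reduce at hij
    split_ifs at hij <;> grind
  · intro i hi
    rcases eq_or_ne i k with rfl | hik
    · simpa using h1.rev
    · rw [if_pos (by omega), if_pos (by omega), if_pos (by omega)]
      exact hP.edge i (by omega)
  · rw [if_neg (by omega), if_neg (by omega), if_pos (by omega), if_neg (by omega),
      if_neg (by omega), if_neg (by omega), if_pos (by omega)]
    exact h2

/-- Take the run of whole hyperedges from `u p` to `u q`. Swapping two vertices inside its first or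
last hyperedge when `p` or `q` is odd makes it start at `u p` and end at `u q`, so that
`false_of_closed` applies. Only this run has to avoid `a`, `x`, `y`. -/
theorem IsLoosePath.false_of_chords {u : ℕ → α} {k : ℕ} (hu : H.IsThreeUniform)
    (hf : H.IsLinearCycleFree) (hP : H.IsLoosePath u k) {p q : ℕ} (hpq : p < q) (hq : q ≤ 2 * k)
    {a x y : α} (h1 : H.Triple a y (u q)) (h2 : H.Triple a x (u p)) (hxy : x ≠ y)
    (hs : ∀ m, 2 * (p / 2) ≤ m → m ≤ 2 * ((q + 1) / 2) → u m ≠ a ∧ u m ≠ x ∧ u m ≠ y) :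
    False := by
  set i := p / 2 with hi
  set j := (q + 1) / 2 with hj
  have hij : i < j := by omega
  have hP1 := hP.segment (i := i) (j := j - i) (by omega)
  obtain ⟨v, hv, hv0, hs1, hve⟩ : ∃ v, H.IsLoosePath v (j - i) ∧ v 0 = u p ∧
      (∀ m ≤ 2 * (j - i), v m ≠ a ∧ v m ≠ x ∧ v m ≠ y) ∧
      (∀ m, p - 2 * i < m → m ≠ 1 → v m = u (2 * i + m)) ∧
      (p % 2 = 0 → v 1 = u (2 * i + 1)) := by
    rcases Nat.mod_two_eq_zero_or_one p with h0 | h0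
    · exact ⟨_, hP1, congrArg u (by omega), fun m hm => hs _ (by omega) (by omega),
        fun m _ _ => rfl, fun _ => rfl⟩
    · refine ⟨_, hP1.swap_first (by omega), ?_, ?_, ?_, by omega⟩
      · simp only [Function.comp, Equiv.swap_apply_left]
        congr 1
        omega
      · intro m hm
        simp only [Function.comp]
        rw [Equiv.swap_apply_def]
        split_ifs <;> exact hs _ (by omega) (by omega)
      · intro m hm hm1
        simp only [Function.comp]
        rw [Equiv.swap_apply_of_ne_of_ne (by omega) (by omega)]
  rcases Nat.mod_two_eq_zero_or_one q with h0 | h0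
  · refine hv.false_of_closed hu hf (by omega) (y := y) ?_ (hv0 ▸ h2) hxy hs1
    rw [hve.1 _ (by omega) (by omega)]
    convert h1 using 2
    omega
  · refine (hv.swap_last (by omega)).false_of_closed hu hf (by omega) (a := a) (x := x) (y := y)
      ?_ ?_ hxy ?_
    · simp only [Function.comp, Equiv.swap_apply_right]
      have : v (2 * (j - i) - 1) = u q := by
        rcases eq_or_ne (2 * (j - i) - 1) 1 with h | h
        · rw [h, hve.2 (by omega)]
          congr 1
          omega
        · rw [hve.1 _ (by omega) h]
          congr 1
          omega
      rwa [this]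
    · simp only [Function.comp]
      rw [Equiv.swap_apply_of_ne_of_ne (by omega) (by omega), hv0]
      exact h2
    · intro m hm
      simp only [Function.comp]
      rw [Equiv.swap_apply_def]
      split_ifs <;> exact hs1 _ (by omega)

/-! ### Longest paths in a counterexample -/

/-- A counterexample to the degree bound whose longest linear path has `k + 1` hyperedges. -/
structure IsExtremal (H : Hypergraph α) (n k : ℕ) : Prop where
  uniform : H.IsThreeUniform
  free : H.IsLinearCycleFree
  finite : V(H).Finite
  card : V(H).ncard = n
  ten_le : 10 ≤ n
  le_degree : ∀ x ∈ V(H), n ≤ H.degree x + 1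
  longest : ∀ u, ¬ H.IsLoosePath u (k + 2)

/-- `{a, b, u 0}` together with the linear path `u` is a linear path with `k + 1` hyperedges. -/
structure IsEnd (H : Hypergraph α) (u : ℕ → α) (k : ℕ) (a b : α) : Prop where
  path : H.IsLoosePath u k
  edge : H.Triple a b (u 0)
  left : ∀ m ≤ 2 * k, u m ≠ a
  right : ∀ m ≤ 2 * k, u m ≠ b

theorem IsEnd.symm {u : ℕ → α} {k : ℕ} {a b : α} (h : H.IsEnd u k a b) : H.IsEnd u k b a :=
  ⟨h.path, h.edge.swap, h.right, h.left⟩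

/-- The indices `i` for which `a` forms a hyperedge with the two last vertices of the `i`-th
hyperedge of the path. -/
def farSet (H : Hypergraph α) (u : ℕ → α) (k : ℕ) (a : α) : Set ℕ :=
  {i | i < k ∧ H.Triple a (u (2 * i + 1)) (u (2 * i + 2))}

/-- The positive indices of path vertices that form a hyperedge with `a` and `c`. -/
def pathSet (H : Hypergraph α) (u : ℕ → α) (k : ℕ) (a c : α) : Set ℕ :=
  {m | 1 ≤ m ∧ m ≤ 2 * k ∧ H.Triple a c (u m)}

/-- The vertices off the path that form a hyperedge with `a` and `c`. -/
def outSet (H : Hypergraph α) (u : ℕ → α) (k : ℕ) (a c : α) : Set α :=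
  {w | (∀ m ≤ 2 * k, u m ≠ w) ∧ H.Triple a c w}

theorem farSet_subset (u : ℕ → α) (k : ℕ) (a : α) : H.farSet u k a ⊆ Set.Iio k := fun _ h => h.1

theorem pathSet_subset (u : ℕ → α) (k : ℕ) (a c : α) :
    H.pathSet u k a c ⊆ Set.Icc 1 (2 * k) := fun _ h => ⟨h.1, h.2.1⟩

theorem pathSet_comm (u : ℕ → α) (k : ℕ) (a c : α) : H.pathSet u k a c = H.pathSet u k c a :=
  Set.ext fun _ => ⟨fun h => ⟨h.1, h.2.1, h.2.2.swap⟩, fun h => ⟨h.1, h.2.1, h.2.2.swap⟩⟩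

theorem outSet_comm (u : ℕ → α) (k : ℕ) (a c : α) : H.outSet u k a c = H.outSet u k c a :=
  Set.ext fun _ => ⟨fun h => ⟨h.1, h.2.swap⟩, fun h => ⟨h.1, h.2.swap⟩⟩

variable {n k : ℕ} {u : ℕ → α} {a b : α}

theorem IsExtremal.finite_outSet (hX : H.IsExtremal n k) (a c : α) : (H.outSet u k a c).Finite :=
  hX.finite.subset fun _ h => h.2.rot'.mem

theorem IsLoosePath.mem (hP : H.IsLoosePath u k) (hk : 1 ≤ k) {m : ℕ} (hm : m ≤ 2 * k) :
    u m ∈ V(H) := by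
  have h1 := fun i hi => (hP.edge i hi).mem
  have h2 := fun i hi => (hP.edge i hi).rot.mem
  have h3 := fun i hi => (hP.edge i hi).rot'.mem
  rcases Nat.even_or_odd' m with ⟨i, rfl | rfl⟩
  · rcases Nat.lt_or_ge i k with h | h
    · exact h1 i h
    · have := h3 (i - 1) (by omega)
      rwa [show 2 * (i - 1) + 2 = 2 * i by omega] at this
  · exact h2 i (by omega)

theorem IsEnd.mem (h : H.IsEnd u k a b) {m : ℕ} (hm : m ≤ 2 * k) : u m ∈ V(H) := by
  rcases Nat.eq_zero_or_pos k with rfl | hk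
  · obtain rfl : m = 0 := by omega
    exact h.edge.rot'.mem
  · exact h.path.mem hk hm

/-- All but `2 * k + 1` vertices lie off the path. -/
theorem IsEnd.ncard_off (hX : H.IsExtremal n k) (h : H.IsEnd u k a b) :
    {w | w ∈ V(H) ∧ ∀ m ≤ 2 * k, u m ≠ w}.ncard + (2 * k + 1) = n := by
  have h1 : (u '' Set.Iic (2 * k)).ncard = 2 * k + 1 := by
    have hinj : Set.InjOn u (Set.Iic (2 * k)) := fun x hx y hy => h.path.inj x y hx hy
    rw [hinj.ncard_image, ← Finset.coe_Iic, Set.ncard_coe_finset, Nat.card_Iic]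
  have h2 : u '' Set.Iic (2 * k) ⊆ V(H) := by
    rintro _ ⟨m, hm, rfl⟩
    exact h.mem hm
  have h3 := Set.ncard_sdiff_add_ncard_of_subset h2 hX.finite
  rw [h1, hX.card] at h3
  convert h3 using 3
  ext w
  simp

/-- Two disjoint sets of vertices off the path have at most `n - (2 * k + 1)` elements together. -/
theorem IsEnd.ncard_le_off (hX : H.IsExtremal n k) (h : H.IsEnd u k a b) {S T : Set α}
    (hS : ∀ w ∈ S, w ∈ V(H) ∧ ∀ m ≤ 2 * k, u m ≠ w) (hT : ∀ w ∈ T, w ∈ V(H) ∧ ∀ m ≤ 2 * k, u m ≠ w)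
    (hd : Disjoint S T) : S.ncard + T.ncard + (2 * k + 1) ≤ n := by
  have hSf : S.Finite := hX.finite.subset fun w hw => (hS w hw).1
  have hTf : T.Finite := hX.finite.subset fun w hw => (hT w hw).1
  rw [← h.ncard_off hX, ← Set.ncard_union_eq hd hSf hTf]
  gcongr
  · exact hX.finite.subset fun w hw => hw.1
  · rintro w (hw | hw)
    · exact hS w hw
    · exact hT w hw

theorem outSet_off (w : α) {c : α} (hw : w ∈ H.outSet u k a c) :
    w ∈ V(H) ∧ ∀ m ≤ 2 * k, u m ≠ w := ⟨hw.2.rot'.mem, hw.1⟩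

/-! ### Hyperedges through an end vertex -/

theorem IsThreeUniform.exists_triple (hu : H.IsThreeUniform) {e : Set α} (he : e ∈ E(H))
    (ha : a ∈ e) : ∃ x y, e = {a, x, y} := by
  obtain ⟨x, y, z, -, -, -, rfl⟩ := Set.ncard_eq_three.1 (hu e he)
  simp only [Set.mem_insert_iff, Set.mem_singleton_iff] at ha
  rcases ha with rfl | rfl | rfl
  · exact ⟨y, z, rfl⟩
  · exact ⟨x, z, Set.insert_comm _ _ _⟩
  · refine ⟨x, y, ?_⟩
    ext t
    simp
    tauto

/-- `{a, x, y}` consists of `a` and the two last vertices of a hyperedge of the path. -/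
def IsFar (u : ℕ → α) (k : ℕ) (x y : α) : Prop :=
  ∃ i < k, x = u (2 * i + 1) ∧ y = u (2 * i + 2) ∨ y = u (2 * i + 1) ∧ x = u (2 * i + 2)

/-- `X` collects the hyperedges at `a` that avoid `u 0` and are not far; the final `1` comes from
the assumed degree `n - 1`. -/
theorem IsExtremal.le_degree_bound (hX : H.IsExtremal n k) (ha : a ∈ V(H)) {X : Set (Set α)}
    (hXf : X.Finite)
    (h : ∀ x y, H.Triple a x y → x ≠ u 0 → y ≠ u 0 → IsFar u k x y ∨ ({a, x, y} : Set α) ∈ X) :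
    n ≤ (H.outSet u k a (u 0)).ncard + (H.pathSet u k a (u 0)).ncard + (H.farSet u k a).ncard +
      X.ncard + 1 := by
  have hof := hX.finite_outSet (u := u) a (u 0)
  have hpf : (H.pathSet u k a (u 0)).Finite := (Set.finite_Icc _ _).subset (pathSet_subset _ _ _ _)
  have hff : (H.farSet u k a).Finite := (Set.finite_Iio _).subset (farSet_subset _ _ _)
  have hsub : {e | e ∈ E(H) ∧ a ∈ e} ⊆
      (fun w => ({a, u 0, w} : Set α)) '' H.outSet u k a (u 0) ∪
      (fun m => ({a, u 0, u m} : Set α)) '' H.pathSet u k a (u 0) ∪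
      (fun i => ({a, u (2 * i + 1), u (2 * i + 2)} : Set α)) '' H.farSet u k a ∪ X := by
    rintro e ⟨he, hae⟩
    have key : ∀ y, H.Triple a (u 0) y → ({a, u 0, y} : Set α) ∈
        (fun w => ({a, u 0, w} : Set α)) '' H.outSet u k a (u 0) ∪
        (fun m => ({a, u 0, u m} : Set α)) '' H.pathSet u k a (u 0) := by
      intro y hy
      by_cases hm : ∃ m ≤ 2 * k, u m = y
      · obtain ⟨m, hm, rfl⟩ := hm
        refine Or.inr ⟨m, ⟨?_, hm, hy⟩, rfl⟩
        rcases Nat.eq_zero_or_pos m with rfl | h0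
        · exact absurd rfl (hy.rot.ne hX.uniform)
        · exact h0
      · push Not at hm
        exact Or.inl ⟨y, ⟨hm, hy⟩, rfl⟩
    obtain ⟨x, y, rfl⟩ := hX.uniform.exists_triple he hae
    by_cases hx : x = u 0
    · subst hx
      exact Or.inl (Or.inl (key y he))
    by_cases hy : y = u 0
    · subst hy
      rw [Set.pair_comm x]
      exact Or.inl (Or.inl (key x (Triple.swap' he)))
    rcases h x y he hx hy with ⟨i, hi, ⟨rfl, rfl⟩ | ⟨rfl, rfl⟩⟩ | h
    · exact Or.inl (Or.inr ⟨i, ⟨hi, he⟩, rfl⟩)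
    · refine Or.inl (Or.inr ⟨i, ⟨hi, Triple.swap' he⟩, ?_⟩)
      simp only [Set.pair_comm]
    · exact Or.inr h
  have h1 := hX.le_degree a ha
  have h2 := Set.ncard_le_ncard hsub
    ((((hof.image _).union (hpf.image _)).union (hff.image _)).union hXf)
  have h3 := Set.ncard_union_le ((fun w => ({a, u 0, w} : Set α)) '' H.outSet u k a (u 0) ∪
      (fun m => ({a, u 0, u m} : Set α)) '' H.pathSet u k a (u 0) ∪
      (fun i => ({a, u (2 * i + 1), u (2 * i + 2)} : Set α)) '' H.farSet u k a) X
  have h4 := Set.ncard_union_le ((fun w => ({a, u 0, w} : Set α)) '' H.outSet u k a (u 0) ∪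
      (fun m => ({a, u 0, u m} : Set α)) '' H.pathSet u k a (u 0))
      ((fun i => ({a, u (2 * i + 1), u (2 * i + 2)} : Set α)) '' H.farSet u k a)
  have h5 := Set.ncard_union_le ((fun w => ({a, u 0, w} : Set α)) '' H.outSet u k a (u 0))
      ((fun m => ({a, u 0, u m} : Set α)) '' H.pathSet u k a (u 0))
  have h6 := Set.ncard_image_le (f := fun w => ({a, u 0, w} : Set α)) hof
  have h7 := Set.ncard_image_le (f := fun m => ({a, u 0, u m} : Set α)) hpf
  have h8 := Set.ncard_image_le (f := fun i => ({a, u (2 * i + 1), u (2 * i + 2)} : Set α)) hff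
  unfold degree at h1
  omega

/-- If `x = u m` comes on the path before any occurrence of `y`, the run from `u 0` to `u m` closes
up through `{a, b, u 0}` and `{a, y, u m}`, unless `y` lies on that run, which is the far case. If
both are off the path, `{x, y, a}` prolongs the longest path. -/
theorem IsEnd.isFar (hX : H.IsExtremal n k) (h : H.IsEnd u k a b) {x y : α}
    (hxy : H.Triple a x y) (hbx : x ≠ b) (hby : y ≠ b) (hcx : x ≠ u 0) (hcy : y ≠ u 0) :
    IsFar u k x y := by
  have key : ∀ x y m, H.Triple a x y → y ≠ b → x ≠ u 0 → m ≤ 2 * k → u m = x →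
      (∀ m' ≤ 2 * k, u m' = y → m < m') → ∃ i < k, x = u (2 * i + 1) ∧ y = u (2 * i + 2) := by
    rintro x y m hxy hby hcx hm rfl hlt
    have hm0 : 0 < m := Nat.pos_of_ne_zero fun h0 => hcx (by rw [h0])
    by_contra hc
    refine h.path.false_of_chords hX.uniform hX.free (p := 0) (q := m) hm0 hm hxy.swap' h.edge
      hby.symm ?_
    -- The run reaches past `m` only for odd `m`, and then only to `m + 1`, so `y` on it means `y =
    -- u (m + 1)`.
    refine fun m' _ hm' => ⟨h.left _ (by omega), h.right _ (by omega), fun heq => hc ?_⟩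
    have := hlt m' (by omega) heq
    refine ⟨m / 2, by omega, ?_, ?_⟩
    · congr 1
      omega
    · rw [← heq]
      congr 1
      omega
  have hne := hxy.rot.ne hX.uniform
  by_cases hx : ∃ m ≤ 2 * k, u m = x <;> by_cases hy : ∃ m ≤ 2 * k, u m = y
  · obtain ⟨m, hm, hmx⟩ := hx
    obtain ⟨m', hm', hmy⟩ := hy
    rcases lt_trichotomy m m' with hlt | rfl | hlt
    · obtain ⟨i, hi, h1⟩ := key x y m hxy hby hcx hm hmx fun l hl hly => by
        rwa [h.path.inj l m' hl hm' (hly.trans hmy.symm)]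
      exact ⟨i, hi, Or.inl h1⟩
    · exact absurd (hmx.symm.trans hmy) hne
    · obtain ⟨i, hi, h1⟩ := key y x m' hxy.swap' hbx hcy hm' hmy fun l hl hlx => by
        rwa [h.path.inj l m hl hm (hlx.trans hmx.symm)]
      exact ⟨i, hi, Or.inr h1⟩
  · obtain ⟨m, hm, hmx⟩ := hx
    obtain ⟨i, hi, h1⟩ := key x y m hxy hby hcx hm hmx fun l hl hly => absurd ⟨l, hl, hly⟩ hy
    exact ⟨i, hi, Or.inl h1⟩
  · obtain ⟨m', hm', hmy⟩ := hy
    obtain ⟨i, hi, h1⟩ := key y x m' hxy.swap' hbx hcy hm' hmy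
      fun l hl hlx => absurd ⟨l, hl, hlx⟩ hx
    exact ⟨i, hi, Or.inr h1⟩
  · push Not at hx hy
    have hP := h.path.cons hX.uniform h.edge h.left h.right
    have hax := hxy.ne hX.uniform
    have hay := hxy.ne' hX.uniform
    refine absurd (hP.cons hX.uniform (x := x) (y := y) (by simpa using hxy.rot) ?_ ?_)
      (hX.longest _)
    · intro m hm
      split_ifs
      · exact hax
      · exact hbx.symm
      · exact hx _ (by omega)
    · intro m hm
      split_ifs
      · exact hay
      · exact hby.symm
      · exact hy _ (by omega)

/-- A hyperedge `{a, u (2 * i + 1), u (2 * i + 2)}` forbids `{a, c, u m}` for later `m`. -/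
theorem IsEnd.le_of_mem_farSet (hX : H.IsExtremal n k) (h : H.IsEnd u k a b) {c : α}
    (hc : c = u 0 ∨ c = b) {i : ℕ} (hi : i ∈ H.farSet u k a) {m : ℕ}
    (hm : m ∈ H.pathSet u k a c) : m ≤ 2 * i + 2 := by
  by_contra hlt
  push Not at hlt
  obtain ⟨h1, h2, h3⟩ := hm
  have hik := hi.1
  have hcne : ∀ l ≤ 2 * k, 1 ≤ l → u l ≠ c := by
    intro l hl hl1
    rcases hc with rfl | rfl
    · intro heq
      have := h.path.inj _ _ hl (by omega) heq
      omega
    · exact h.right l hl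
  -- The run starts at index `2 * i + 2`, so it misses `u (2 * i + 1)`.
  refine h.path.false_of_chords hX.uniform hX.free (p := 2 * i + 2) (q := m) hlt h2 h3 hi.2
    (hcne _ (by omega) (by omega)) fun l hl hl' => ⟨h.left _ (by omega), fun heq => ?_,
      hcne _ (by omega) (by omega)⟩
  have := h.path.inj _ _ (by omega) (by omega) heq
  omega

theorem IsEnd.cut (hX : H.IsExtremal n k) (h : H.IsEnd u k a b) :
    (H.pathSet u k a (u 0)).ncard + (H.farSet u k a).ncard ≤ 2 * k ∨
      (H.pathSet u k a (u 0)).ncard + (H.farSet u k a).ncard = 2 * k + 1 ∧ 1 ≤ k ∧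
        k - 1 ∈ H.farSet u k a ∧ H.pathSet u k a (u 0) = Set.Icc 1 (2 * k) :=
  ncard_add_ncard_le_of_cut (pathSet_subset _ _ _ _) (farSet_subset _ _ _)
    fun _ hi _ hm => h.le_of_mem_farSet hX (Or.inl rfl) hi hm

/-- If `{a, u (2 * i + 1), u (2 * i + 2)}` and `{a, c, x}` are hyperedges, then neither
`{b, u 0, u (2 * i + 1)}` nor `{b, u 0, u (2 * i + 2)}` is one. -/
theorem IsEnd.notMem_pathSet (hX : H.IsExtremal n k) (h : H.IsEnd u k a b) {i : ℕ}
    (hi : i ∈ H.farSet u k a) {c x : α} (hc : c = u 0 ∨ c = b) (hx : H.Triple a c x)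
    (hxb : x ≠ b) (hx0 : x ≠ u 0) (hx1 : x ≠ u (2 * i + 1)) (hx2 : x ≠ u (2 * i + 2)) :
    2 * i + 1 ∉ H.pathSet u k b (u 0) ∧ 2 * i + 2 ∉ H.pathSet u k b (u 0) := by
  have hik := hi.1
  have hf := hi.2
  have hne : ∀ l m, l ≤ 2 * k → m ≤ 2 * k → l ≠ m → u l ≠ u m := fun l m h1 h2 h3 h4 =>
    h3 (h.path.inj _ _ h1 h2 h4)
  have key : ∀ p q, (p = 2 * i + 1 ∧ q = 2 * i + 2 ∨ p = 2 * i + 2 ∧ q = 2 * i + 1) →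
      ¬ H.Triple b (u 0) (u p) := by
    intro p q hpq hb
    have hfq : H.Triple (u p) (u q) a := by
      rcases hpq with ⟨rfl, rfl⟩ | ⟨rfl, rfl⟩
      · exact hf.rot
      · exact hf.rev
    have hxq : x ≠ u q := by rcases hpq with ⟨rfl, rfl⟩ | ⟨rfl, rfl⟩ <;> assumption
    have hxp : x ≠ u p := by rcases hpq with ⟨rfl, rfl⟩ | ⟨rfl, rfl⟩ <;> assumption
    have hab := h.edge.ne hX.uniform
    rcases hc with rfl | rfl
    · exact hX.free.false_of_triangle hX.uniform hfq hx.swap' hb.swap hxq.symm (h.right _ (by omega))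
        hxb (hne _ _ (by omega) (by omega) (by omega)) hxp hab.symm
    · exact hX.free.false_of_triangle hX.uniform hfq hx.swap' hb hxq.symm
        (hne _ _ (by omega) (by omega) (by omega))
        hx0 (h.right _ (by omega)) hxp (h.left _ (by omega))
  exact ⟨fun hm => key _ _ (Or.inl ⟨rfl, rfl⟩) hm.2.2, fun hm => key _ _ (Or.inr ⟨rfl, rfl⟩) hm.2.2⟩

/-! ### Uniqueness of the vertex off the path that completes `{a, u 0}` -/

theorem IsEnd.of_mem_outSet (h : H.IsEnd u k a b) {w : α} (hw : w ∈ H.outSet u k a (u 0)) :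
    H.IsEnd u k a w :=
  ⟨h.path, hw.2.swap', h.left, hw.1⟩

theorem IsEnd.mem_outSet (h : H.IsEnd u k a b) : b ∈ H.outSet u k a (u 0) :=
  ⟨h.right, h.edge.swap'⟩

theorem IsEnd.ncard_outSet_add_le (hX : H.IsExtremal n k) (h : H.IsEnd u k a b) (c : α) :
    (H.outSet u k a c).ncard + (2 * k + 2) ≤ n := by
  have := h.ncard_le_off hX (S := H.outSet u k a c) (T := {a}) (fun w => outSet_off w) ?_ ?_
  · rw [Set.ncard_singleton] at this
    omega
  · rintro w rfl
    exact ⟨h.edge.mem, h.left⟩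
  · rw [Set.disjoint_singleton_right]
    intro ha
    exact absurd rfl (ha.2.ne' hX.uniform)

/-- If `a` has three neighbours off the path, every hyperedge through `a` that avoids `u 0`
is far. -/
theorem IsEnd.isFar_of_three (hX : H.IsExtremal n k) (h : H.IsEnd u k a b)
    (h3 : 3 ≤ (H.outSet u k a (u 0)).ncard) {x y : α} (hxy : H.Triple a x y) (hx : x ≠ u 0)
    (hy : y ≠ u 0) : IsFar u k x y := by
  by_contra hc
  have hsub : H.outSet u k a (u 0) ⊆ {x, y} := by
    intro w hw
    by_contra hwxy
    simp only [Set.mem_insert_iff, Set.mem_singleton_iff, not_or] at hwxy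
    exact hc ((h.of_mem_outSet hw).isFar hX hxy (Ne.symm hwxy.1) (Ne.symm hwxy.2) hx hy)
  have h1 := Set.ncard_le_ncard hsub (Set.toFinite _)
  have h2 := Set.ncard_insert_le x {y}
  rw [Set.ncard_singleton] at h2
  omega

/-- With three such vertices, the degrees of `a` and `b` both force the equality case of
`IsEnd.cut`. Its full path set at `b` contradicts `IsEnd.notMem_pathSet`, applied to the far index
`k - 1` at `a` and a vertex `w ≠ b`. -/
theorem IsEnd.ncard_outSet_le_two (hX : H.IsExtremal n k) (h : H.IsEnd u k a b) :
    (H.outSet u k a (u 0)).ncard ≤ 2 := by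
  by_contra h3
  push Not at h3
  have hbound : ∀ c, H.IsEnd u k c a ∨ c = a → n ≤ (H.outSet u k c (u 0)).ncard +
      (H.pathSet u k c (u 0)).ncard + (H.farSet u k c).ncard + 1 := by
    intro c hc
    have hcV : c ∈ V(H) := by
      rcases hc with hc | rfl
      exacts [hc.edge.mem, h.edge.mem]
    have := hX.le_degree_bound (u := u) hcV (X := ∅) Set.finite_empty fun x y hxy hx hy =>
      Or.inl ?_
    · simpa using this
    · rcases hc with hc | rfl
      · by_cases hxa : x = a
        · subst hxa
          obtain ⟨i, hi, ⟨h1, -⟩ | ⟨-, h1⟩⟩ := h.isFar_of_three hX h3 hxy.swap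
            (hc.edge.ne' hX.uniform) hy
          · exact absurd h1.symm (hc.left _ (by omega))
          · exact absurd h1.symm (hc.left _ (by omega))
        by_cases hya : y = a
        · subst hya
          obtain ⟨i, hi, ⟨h1, -⟩ | ⟨-, h1⟩⟩ := h.isFar_of_three hX h3 hxy.rot'
            (hc.edge.ne' hX.uniform) hx
          · exact absurd h1.symm (hc.left _ (by omega))
          · exact absurd h1.symm (hc.left _ (by omega))
        exact hc.isFar hX hxy hxa hya hx hy
      · exact h.isFar_of_three hX h3 hxy hx hy
  have h1 := hbound a (Or.inr rfl)
  have h2 := h.ncard_outSet_add_le hX (u 0)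
  have h4 := hbound b (Or.inl h.symm)
  have h5 := h.symm.ncard_outSet_add_le hX (u 0)
  rcases h.cut hX with hc | ⟨-, hk, hfar, -⟩
  · omega
  rcases h.symm.cut hX with hc' | ⟨-, -, -, hall⟩
  · omega
  obtain ⟨w, hw, hwb⟩ := Set.exists_ne_of_one_lt_ncard
    (by omega : 1 < (H.outSet u k a (u 0)).ncard) b
  have := (h.notMem_pathSet hX hfar (Or.inl rfl) hw.2 hwb (hw.1 0 (by omega)).symm
    (hw.1 _ (by omega)).symm (hw.1 _ (by omega)).symm).1
  rw [hall] at this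
  exact this ⟨by omega, by omega⟩

/-- Given a second vertex `w`, only `{a, b, w}` can avoid `u 0` and fail to be far at `b` or `w`.
Far hyperedges at one of `b`, `w` block path hyperedges at the other, and the two degree counts
become tight; the hyperedges this yields contain a triangle on `b`, `w`, `u 0`. -/
theorem IsEnd.eq_of_mem_outSet (hX : H.IsExtremal n k) (h : H.IsEnd u k a b) {w : α}
    (hw : w ∈ H.outSet u k a (u 0)) : w = b := by
  by_contra hwb
  have h' := h.of_mem_outSet hw
  have hout : H.outSet u k a (u 0) = {b, w} := by
    refine (Set.eq_of_subset_of_ncard_le ?_ ?_ (hX.finite_outSet _ _)).symm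
    · rintro x (rfl | rfl)
      exacts [h.mem_outSet, hw]
    · rw [Set.ncard_pair (Ne.symm hwb)]
      exact h.ncard_outSet_le_two hX
  have hX1 : ∀ x y, H.Triple a x y → x ≠ u 0 → y ≠ u 0 → IsFar u k x y ∨
      (x = b ∧ y = w ∨ x = w ∧ y = b) := by
    intro x y hxy hx hy
    by_contra hc
    push Not at hc
    by_cases h1 : x = b
    · exact hc.1 (h'.isFar hX hxy (by rintro rfl; exact hwb h1) (fun h2 => hc.2.1 h1 h2) hx hy)
    by_cases h2 : y = b
    · exact hc.1 (h'.isFar hX hxy (fun h3 => hc.2.2 h3 h2) (by rintro rfl; exact hwb h2) hx hy)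
    exact hc.1 (h.isFar hX hxy h1 h2 hx hy)
  have hfarne : ∀ {v x y : α}, H.IsEnd u k v a → IsFar u k x y → x ≠ v ∧ y ≠ v := by
    rintro v x y hv ⟨i, hi, ⟨rfl, rfl⟩ | ⟨rfl, rfl⟩⟩ <;>
      exact ⟨hv.left _ (by omega), hv.left _ (by omega)⟩
  have hbound : ∀ c c', H.IsEnd u k c a → (c = b ∧ c' = w ∨ c = w ∧ c' = b) →
      ∃ X : Set (Set α), X.ncard ≤ 1 ∧ (X.ncard = 1 → H.Triple a b w) ∧
      n ≤ (H.outSet u k c (u 0)).ncard + (H.pathSet u k c (u 0)).ncard +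
        (H.farSet u k c).ncard + X.ncard + 1 := by
    intro c c' hc hcc
    refine ⟨{e | e = {c, a, c'} ∧ e ∈ E(H)}, ?_, ?_, ?_⟩
    · refine (Set.ncard_le_ncard (t := {({c, a, c'} : Set α)}) (fun e he => he.1)
        (Set.finite_singleton _)).trans (Set.ncard_singleton _).le
    · intro h1
      obtain ⟨e, rfl, he⟩ := Set.nonempty_of_ncard_ne_zero (by omega :
        {e : Set α | e = {c, a, c'} ∧ e ∈ E(H)}.ncard ≠ 0)
      rcases hcc with ⟨rfl, rfl⟩ | ⟨rfl, rfl⟩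
      · exact Triple.swap he
      · exact Triple.rot he
    · refine hX.le_degree_bound hc.edge.mem ((Set.finite_singleton ({c, a, c'} : Set α)).subset
        fun e he => he.1) fun x y hxy hx hy => ?_
      have hac := hc.edge.rot.ne hX.uniform
      have key : ∀ z, H.Triple a c z → z ≠ u 0 → z = c' := by
        intro z hz hz0
        rcases hX1 c z hz (hc.edge.ne' hX.uniform) hz0 with hf | ⟨h1, h2⟩ | ⟨h1, h2⟩
        · exact absurd rfl (hfarne hc hf).1
        · rcases hcc with ⟨h3, h4⟩ | ⟨h3, h4⟩
          · rw [h2, h4]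
          · exact absurd (h3.symm.trans h1) hwb
        · rcases hcc with ⟨h3, h4⟩ | ⟨h3, h4⟩
          · exact absurd (h1.symm.trans h3) hwb
          · rw [h2, h4]
      by_cases hxa : x = a
      · subst hxa
        obtain rfl := key y hxy.swap hy
        exact Or.inr ⟨rfl, hxy⟩
      by_cases hya : y = a
      · subst hya
        obtain rfl := key x hxy.rot' hx
        refine Or.inr ⟨?_, hxy⟩
        rw [Set.pair_comm]
      exact Or.inl (hc.isFar hX hxy hxa hya hx hy)
  obtain ⟨X, hX1', hXT, hb⟩ := hbound b w h.symm (Or.inl ⟨rfl, rfl⟩)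
  obtain ⟨Y, hY1, hYT, hw'⟩ := hbound w b h'.symm (Or.inr ⟨rfl, rfl⟩)
  have hjoint : ∀ c c', H.IsEnd u k c a → H.IsEnd u k c' a → c ≠ c' →
      (H.pathSet u k c' (u 0)).ncard + 2 * (H.farSet u k c).ncard ≤ 2 * k := by
    intro c c' hc hc' hne
    refine ncard_add_two_mul_ncard_le (pathSet_subset _ _ _ _) (farSet_subset _ _ _) fun i hi => ?_
    have hik := hi.1
    have hcc' : ∀ p q, (p = 2 * i + 1 ∧ q = 2 * i + 2 ∨ p = 2 * i + 2 ∧ q = 2 * i + 1) →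
        p ∉ H.pathSet u k c' (u 0) := by
      intro p q hpq hp
      have hfq : H.Triple (u p) (u q) c := by
        rcases hpq with ⟨rfl, rfl⟩ | ⟨rfl, rfl⟩
        · exact hi.2.rot
        · exact hi.2.rev
      exact hX.free.false_of_triangle hX.uniform hfq hc.edge hp.2.2.swap (hc.right _ (by omega))
        (hc'.left _ (by omega)) (hc'.edge.swap.ne hX.uniform)
        (fun heq => by
          have := h.path.inj _ _ (by omega) (by omega) heq
          omega) (hc.right _ (by omega)).symm hne.symm
    exact ⟨hcc' _ _ (Or.inl ⟨rfl, rfl⟩), hcc' _ _ (Or.inr ⟨rfl, rfl⟩)⟩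
  have hj1 := hjoint b w h.symm h'.symm (Ne.symm hwb)
  have hj2 := hjoint w b h'.symm h.symm hwb
  have ho1 := h.symm.ncard_outSet_le_two hX
  have ho2 := h'.symm.ncard_outSet_le_two hX
  have hn : 2 * k + 4 ≤ n := by
    have := h.ncard_outSet_add_le hX (u 0)
    rw [hout, Set.ncard_pair (Ne.symm hwb)] at this
    omega
  have hten := hX.ten_le
  -- The bounds add up to `4 * k + 8 ≤ 2 * n ≤ 4 * k + 8` minus the sizes of both far sets, so every
  -- estimate is an equality.
  have hT := hXT (by omega)
  have hall : ∀ c, 2 * k ≤ (H.pathSet u k c (u 0)).ncard → H.pathSet u k c (u 0) = Set.Icc 1 (2 * k) :=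
    fun c hc => eq_Icc_of_le_ncard (pathSet_subset _ _ _ _) (by omega)
  have hb1 : 1 ∈ H.pathSet u k b (u 0) := by
    rw [hall b (by omega)]
    exact ⟨le_rfl, by omega⟩
  have hw2 : 2 ∈ H.pathSet u k w (u 0) := by
    rw [hall w (by omega)]
    exact ⟨by omega, by omega⟩
  exact hX.free.false_of_triangle hX.uniform (x := b) (y := w) (z := u 0) hT.swap hw2.2.2.swap'
    hb1.2.2.rot (h.left _ (by omega)).symm (h.left _ (by omega)).symm
    (fun heq => by
      have := h.path.inj _ _ (by omega) (by omega) heq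
      omega) (h.left _ (by omega)).symm (h.right _ (by omega)) (h'.right _ (by omega))

theorem IsEnd.outSet_eq (hX : H.IsExtremal n k) (h : H.IsEnd u k a b) :
    H.outSet u k a (u 0) = {b} :=
  Set.eq_singleton_iff_unique_mem.2 ⟨h.mem_outSet, fun _ hw => h.eq_of_mem_outSet hX hw⟩

/-! ### Counting hyperedges through the end pair `{a, b}` -/

theorem IsEnd.ncard_outSet_pair_add_le (hX : H.IsExtremal n k) (h : H.IsEnd u k a b) :
    (H.outSet u k a b).ncard + (2 * k + 3) ≤ n := by
  have hab := h.edge.ne hX.uniform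
  have := h.ncard_le_off hX (S := H.outSet u k a b) (T := {a, b})
    (fun w => outSet_off w) ?_ ?_
  · rw [Set.ncard_pair hab] at this
    omega
  · rintro w (rfl | rfl)
    exacts [⟨h.edge.mem, h.left⟩, ⟨h.symm.edge.mem, h.right⟩]
  · rw [Set.disjoint_right]
    rintro w (rfl | rfl) hw
    exacts [hw.2.ne' hX.uniform rfl, hw.2.rot.ne hX.uniform rfl]

/-- In the constant `2`, one unit is the hyperedge `{a, b, u 0}`, the other the `1` of
`le_degree_bound`. -/
theorem IsEnd.le_bound (hX : H.IsExtremal n k) (h : H.IsEnd u k a b) :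
    n ≤ (H.pathSet u k a (u 0)).ncard + (H.farSet u k a).ncard + (H.pathSet u k a b).ncard +
      (H.outSet u k a b).ncard + 2 := by
  have hpf : (H.pathSet u k a b).Finite := (Set.finite_Icc _ _).subset (pathSet_subset _ _ _ _)
  have hof := hX.finite_outSet (u := u) a b
  have key : ∀ y, H.Triple a b y → y ≠ u 0 → ({a, b, y} : Set α) ∈
      (fun m => ({a, b, u m} : Set α)) '' H.pathSet u k a b ∪
      (fun w => ({a, b, w} : Set α)) '' H.outSet u k a b := by
    intro y hy hy0
    by_cases hm : ∃ m ≤ 2 * k, u m = y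
    · obtain ⟨m, hm, rfl⟩ := hm
      exact Or.inl ⟨m, ⟨Nat.pos_of_ne_zero fun h0 => hy0 (by rw [h0]), hm, hy⟩, rfl⟩
    · push Not at hm
      exact Or.inr ⟨y, ⟨hm, hy⟩, rfl⟩
  have h1 := hX.le_degree_bound (u := u) h.edge.mem
    (X := (fun m => ({a, b, u m} : Set α)) '' H.pathSet u k a b ∪
      (fun w => ({a, b, w} : Set α)) '' H.outSet u k a b)
    ((hpf.image _).union (hof.image _))
    fun x y hxy hx hy => by
      by_cases hxb : x = b
      · subst hxb
        exact Or.inr (key y hxy hy)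
      by_cases hyb : y = b
      · subst hyb
        rw [Set.pair_comm]
        exact Or.inr (key x hxy.swap' hx)
      exact Or.inl (h.isFar hX hxy hxb hyb hx hy)
  have h2 := Set.ncard_union_le ((fun m => ({a, b, u m} : Set α)) '' H.pathSet u k a b)
    ((fun w => ({a, b, w} : Set α)) '' H.outSet u k a b)
  have h3 := Set.ncard_image_le (f := fun m => ({a, b, u m} : Set α)) hpf
  have h4 := Set.ncard_image_le (f := fun w => ({a, b, w} : Set α)) hof
  have h5 : (H.outSet u k a (u 0)).ncard = 1 := by
    rw [h.outSet_eq hX, Set.ncard_singleton]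
  omega

/-- If a far index `i` at `a` failed to block its pair, `notMem_pathSet` would confine the third
vertices next to `{a, u 0}` and `{a, b}` to four vertices. Then `n ≤ k + 6`, against `n ≥ 2 * k + 3`
and `n ≥ 10`. -/
theorem IsEnd.ncard_pathSet_add_farSet_le (hX : H.IsExtremal n k) (h : H.IsEnd u k a b) :
    (H.pathSet u k b (u 0)).ncard + 2 * (H.farSet u k a).ncard ≤ 2 * k := by
  refine ncard_add_two_mul_ncard_le (pathSet_subset _ _ _ _) (farSet_subset _ _ _) fun i hi => ?_
  by_contra hcon
  have hcx : ∀ c x, (c = u 0 ∨ c = b) → H.Triple a c x → x = b ∨ x = u 0 ∨ x = u (2 * i + 1) ∨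
      x = u (2 * i + 2) := by
    intro c x hc hx
    by_contra hne
    push Not at hne
    exact hcon (h.notMem_pathSet hX hi hc hx hne.1 hne.2.1 hne.2.2.1 hne.2.2.2)
  have hik := hi.1
  have hpath : ∀ c, (c = u 0 ∨ c = b) → (H.pathSet u k a c).ncard ≤ 2 := by
    intro c hc
    refine (ncard_le_of_subset_Icc (p := 2 * i + 1) (q := 2 * i + 2) fun m hm => ?_).trans (by omega)
    obtain ⟨h1, h2, h3⟩ := hm
    rcases hcx c _ hc h3 with h4 | h4 | h4 | h4
    · exact absurd h4 (h.right _ h2)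
    all_goals
      have := h.path.inj _ _ h2 (by omega) h4
      simp only [Set.mem_Icc]
      omega
  have hout : H.outSet u k a b = ∅ := by
    refine Set.eq_empty_of_forall_notMem fun w hw => ?_
    rcases hcx b w (Or.inr rfl) hw.2 with h4 | h4 | h4 | h4
    · exact hw.2.rot.ne hX.uniform h4.symm
    · exact hw.1 _ (by omega) h4.symm
    · exact hw.1 _ (by omega) h4.symm
    · exact hw.1 _ (by omega) h4.symm
  have h1 := h.le_bound hX
  rw [hout, Set.ncard_empty] at h1
  have h2 := hpath _ (Or.inl rfl)
  have h3 := hpath _ (Or.inr rfl)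
  have h4 := ncard_le_of_subset_Iio fun j hj => ⟨Nat.zero_le j, farSet_subset (H := H) u k a hj⟩
  have h5 := h.ncard_outSet_pair_add_le hX
  have := hX.ten_le
  omega

/-- For each such `w`, `{b, w, a}` followed by `v` is again a longest path, and the completion of
`{b, v 0}` off `v` is unique. -/
theorem IsEnd.ncard_outSet_pair_le_one (hX : H.IsExtremal n k) (h : H.IsEnd u k a b) {v : ℕ → α}
    (hv : H.IsLoosePath v k) (hv0 : v 0 = a) (hvu : ∀ m ≤ 2 * k, v m = a ∨ ∃ l ≤ 2 * k, v m = u l) :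
    (H.outSet u k a b).ncard ≤ 1 := by
  have hoff : ∀ w, w ≠ a → (∀ m ≤ 2 * k, u m ≠ w) → ∀ m ≤ 2 * k, v m ≠ w := by
    rintro w hwa hw m hm rfl
    rcases hvu m hm with h1 | ⟨l, hl, h1⟩
    · exact hwa h1
    · exact hw l hl h1.symm
  have hb := hoff b (h.edge.ne hX.uniform).symm h.right
  have hend : ∀ w ∈ H.outSet u k a b, H.IsEnd v k b w := fun w hw =>
    ⟨hv, hv0 ▸ hw.2.rot, hb, hoff w (hw.2.ne' hX.uniform).symm hw.1⟩
  rw [Set.ncard_le_one (hX.finite_outSet _ _)]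
  exact fun w hw w' hw' => (hend w' hw').eq_of_mem_outSet hX (hend w hw).mem_outSet

theorem Triple.isLoosePath (hu : H.IsThreeUniform) {x y z : α} (h : H.Triple x y z) :
    H.IsLoosePath (fun m => if m = 0 then x else if m = 1 then y else z) 1 where
  inj i j hi hj hij := by
    have h1 := h.ne hu
    have h2 := h.ne' hu
    have h3 := h.rot.ne hu
    split_ifs at hij <;> grind
  edge i hi := by
    obtain rfl : i = 0 := by omega
    simpa

/-- For `k = 1`, a hyperedge `{a, u p, u q}` is itself a path starting at `a`, so the previous bound
applies and `n ≤ 8`; without one, the degree of `a` is too small. -/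
theorem IsEnd.two_le (hX : H.IsExtremal n k) (h : H.IsEnd u k a b) : 2 ≤ k := by
  have h1 := h.le_bound hX
  have h2 := h.ncard_outSet_pair_add_le hX
  have h3 := ncard_le_of_subset_Icc (pathSet_subset (H := H) u k a b)
  have h4 := ncard_le_of_subset_Icc (pathSet_subset (H := H) u k a (u 0))
  have h5 := ncard_le_of_subset_Iio fun j hj => ⟨Nat.zero_le j, farSet_subset (H := H) u k a hj⟩
  have h10 := hX.ten_le
  by_contra hk
  obtain rfl : k = 1 := by omega
  have key : ∀ p q, p ≤ 2 → q ≤ 2 → ¬ H.Triple a (u p) (u q) := by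
    intro p q hp hq ht
    have := h.ncard_outSet_pair_le_one hX (ht.isLoosePath hX.uniform) rfl fun m hm => by
      split_ifs
      · exact Or.inl rfl
      · exact Or.inr ⟨p, hp, rfl⟩
      · exact Or.inr ⟨q, hq, rfl⟩
    omega
  have h6 : H.pathSet u 1 a (u 0) = ∅ := Set.eq_empty_of_forall_notMem fun m hm =>
    key 0 m (by omega) hm.2.1 hm.2.2
  have h7 : H.farSet u 1 a = ∅ := Set.eq_empty_of_forall_notMem fun i hi =>
    key (2 * i + 1) (2 * i + 2) (by have := hi.1; omega) (by have := hi.1; omega) hi.2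
  rw [h6, h7, Set.ncard_empty] at h1
  omega

theorem IsEnd.ncard_outSet_pair_le_one_of_triple (hX : H.IsExtremal n k) (h : H.IsEnd u k a b)
    (ht : H.Triple a (u 0) (u 2)) : (H.outSet u k a b).ncard ≤ 1 := by
  have hk := h.two_le hX
  refine h.ncard_outSet_pair_le_one hX
    (v := fun m => if m = 0 then a else if m = 1 then u 0 else u m) ⟨?_, ?_⟩ rfl ?_
  · intro i j hi hj hij
    have h0 := h.left 0 (by omega)
    have h1 := h.left i hi
    have h2 := h.left j hj
    have h3 := h.path.inj i 0 hi (by omega)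
    have h4 := h.path.inj j 0 hj (by omega)
    have h5 := h.path.inj i j hi hj
    split_ifs at hij <;> grind
  · intro i hi
    rcases Nat.eq_zero_or_pos i with rfl | h0
    · simpa using ht
    · have := h.path.edge i hi
      rwa [if_neg (by omega), if_neg (by omega), if_neg (by omega), if_neg (by omega),
        if_neg (by omega), if_neg (by omega)]
  · intro m hm
    split_ifs
    · exact Or.inl rfl
    · exact Or.inr ⟨0, by omega, rfl⟩
    · exact Or.inr ⟨m, hm, rfl⟩

theorem IsEnd.eq_one_or_of_ne (hX : H.IsExtremal n k) (h : H.IsEnd u k a b) {m m' : ℕ}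
    (hm : m ∈ H.pathSet u k a (u 0)) (hm' : m' ∈ H.pathSet u k a b) (hne : m ≠ m') :
    m = 1 ∨ m = 2 ∧ m' = 1 := by
  obtain ⟨h1, h2, h3⟩ := hm
  obtain ⟨h1', h2', h3'⟩ := hm'
  have hu0 : ∀ l, l ≤ 2 * k → 1 ≤ l → u l ≠ u 0 := fun l hl hl1 heq => by
    have := h.path.inj _ _ hl (by omega) heq
    omega
  by_contra hc
  rcases lt_or_gt_of_ne hne with hlt | hlt
  · exact h.path.false_of_chords hX.uniform hX.free hlt h2' h3' h3 (h.right _ (by omega))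
      fun l hl hl' => ⟨h.left _ (by omega), hu0 _ (by omega) (by omega), h.right _ (by omega)⟩
  -- If the run from `u 0` to `u m'` stops before `u m`, it closes up through `{a, u 0, u m}`.
  -- Otherwise `m = m' + 1` lies in the same hyperedge, which misses `u 0` since `m' ≠ 1` and closes
  -- up alone.
  · by_cases hs : 2 * ((m' + 1) / 2) < m
    · refine h.path.false_of_chords hX.uniform hX.free (p := 0) (q := m') (by omega) h2' h3'
        h3.swap' (h.right _ h2) fun l hl hl' => ⟨h.left _ (by omega), fun heq => ?_,
          h.right _ (by omega)⟩
      have := h.path.inj _ _ (by omega) h2 heq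
      omega
    · exact h.path.false_of_chords hX.uniform hX.free hlt h2 h3 h3' (h.right _ (by omega)).symm
        fun l hl hl' => ⟨h.left _ (by omega), h.right _ (by omega), hu0 _ (by omega) (by omega)⟩

/-- As `hb` holds, the far set of `a` has at most `k - 1` elements. An index `≥ 3` leaves so few
path hyperedges that it would need `2 * k - 2`; index `2` bounds the off-path ones as well and gives
`n ≤ k + 6`. -/
theorem IsEnd.eq_one_of_nonempty (hX : H.IsExtremal n k) (h : H.IsEnd u k a b)
    (hb : (H.pathSet u k b (u 0)).ncard ≠ 0)
    (hab : (H.pathSet u k a b).Nonempty) {m : ℕ} (hm : m ∈ H.pathSet u k a (u 0)) : m = 1 := by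
  have h1 := h.le_bound hX
  have h2 := h.ncard_outSet_pair_add_le hX
  have h3 := h.ncard_pathSet_add_farSet_le hX
  have h10 := hX.ten_le
  have hk := h.two_le hX
  obtain ⟨m', hm'⟩ := hab
  have key : ∀ i ∈ H.pathSet u k a (u 0), i < 3 := by
    intro i hi
    by_contra hi3
    have hN : H.pathSet u k a b ⊆ Set.Icc i i := by
      intro j hj
      by_contra hne
      have := h.eq_one_or_of_ne hX hi hj (by rintro rfl; exact hne (by simp))
      omega
    have hM : H.pathSet u k a (u 0) ⊆ {1, i} := by
      intro l hl
      by_cases hli : l = i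
      · exact Or.inr hli
      · have hm'i : m' = i := by simpa using hN hm'
        have := h.eq_one_or_of_ne hX hl hm' (by omega)
        left
        omega
    have h4 := ncard_le_of_subset_Icc hN
    have h5 := Set.ncard_le_ncard hM (Set.toFinite _)
    have h6 := Set.ncard_insert_le 1 {i}
    rw [Set.ncard_singleton] at h6
    omega
  by_contra hm1
  have hm2 : m = 2 := by
    have := key m hm
    have := hm.1
    omega
  subst hm2
  have hM : H.pathSet u k a (u 0) ⊆ Set.Icc 1 2 := fun i hi => ⟨hi.1, by have := key i hi; omega⟩
  have hN : H.pathSet u k a b ⊆ Set.Icc 1 2 := by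
    intro j hj
    by_cases hj2 : 2 = j
    · simp [← hj2]
    · have := h.eq_one_or_of_ne hX hm hj hj2
      simp only [Set.mem_Icc]
      omega
  have h4 := ncard_le_of_subset_Icc hM
  have h5 := ncard_le_of_subset_Icc hN
  have h6 := h.ncard_outSet_pair_le_one_of_triple hX hm.2.2
  omega

/-- The degree of `a` then forces the equality case of the cut bound for `{a, b}`, and leaves no
vertex off the path unused. -/
theorem IsEnd.triple_of_ncard_eq_zero (hX : H.IsExtremal n k) (h : H.IsEnd u k a b)
    (ha : (H.pathSet u k a (u 0)).ncard = 0) :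
    k - 1 ∈ H.farSet u k a ∧ ∀ x ∈ V(H), x ≠ a → x ≠ b → H.Triple a b x := by
  have h1 := h.le_bound hX
  have h2 := h.ncard_outSet_pair_add_le hX
  rcases ncard_add_ncard_le_of_cut (pathSet_subset (H := H) u k a b) (farSet_subset u k a)
    fun _ hi _ hm => h.le_of_mem_farSet hX (Or.inr rfl) hi hm with h3 | ⟨h3, -, hfar, hall⟩
  · omega
  refine ⟨hfar, fun x hx hxa hxb => ?_⟩
  by_cases hm : ∃ m ≤ 2 * k, u m = x
  · obtain ⟨m, hm, rfl⟩ := hm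
    rcases Nat.eq_zero_or_pos m with rfl | h0
    · exact h.edge
    · have : m ∈ H.pathSet u k a b := by
        rw [hall]
        exact ⟨h0, hm⟩
      exact this.2.2
  · push Not at hm
    by_contra hc
    have hab := h.edge.ne hX.uniform
    have := h.ncard_le_off hX (S := H.outSet u k a b) (T := {x, a, b})
      (fun w => outSet_off w) ?_ ?_
    · have h3' : ({x, a, b} : Set α).ncard = 3 :=
        Set.ncard_eq_three.2 ⟨x, a, b, hxa, hxb, hab, rfl⟩
      omega
    · rintro w (rfl | rfl | rfl)
      exacts [⟨hx, hm⟩, ⟨h.edge.mem, h.left⟩, ⟨h.symm.edge.mem, h.right⟩]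
    · rw [Set.disjoint_right]
      rintro w (rfl | rfl | rfl) hw
      exacts [hc hw.2, hw.2.ne' hX.uniform rfl, hw.2.rot.ne hX.uniform rfl]

/-- If neither path set at `u 0` is empty, the counts at `a` and `b` together yield some `{a, b, u
m}`, and `eq_one_of_nonempty` leaves index `1` alone. -/
theorem IsEnd.dichotomy (hX : H.IsExtremal n k) (h : H.IsEnd u k a b) :
    (H.Triple a (u 0) (u 1) ∧ 2 * k ≤ (H.pathSet u k a b).ncard + (H.farSet u k a).ncard) ∨
    ((k - 1 ∈ H.farSet u k a ∨ k - 1 ∈ H.farSet u k b) ∧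
      ∀ x ∈ V(H), x ≠ a → x ≠ b → H.Triple a b x) := by
  by_cases ha : (H.pathSet u k a (u 0)).ncard = 0
  · have := h.triple_of_ncard_eq_zero hX ha
    exact Or.inr ⟨Or.inl this.1, this.2⟩
  by_cases hb : (H.pathSet u k b (u 0)).ncard = 0
  · have := h.symm.triple_of_ncard_eq_zero hX hb
    exact Or.inr ⟨Or.inr this.1, fun x hx hxa hxb => (this.2 x hx hxb hxa).swap⟩
  have h1 := h.le_bound hX
  have h1' := h.symm.le_bound hX
  have h2 := h.ncard_outSet_pair_add_le hX
  have h3 := h.ncard_pathSet_add_farSet_le hX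
  have h3' := h.symm.ncard_pathSet_add_farSet_le hX
  rw [pathSet_comm u k b a, outSet_comm u k b a] at h1'
  have hab : (H.pathSet u k a b).Nonempty := Set.nonempty_of_ncard_ne_zero (by omega)
  have hM : ∀ m ∈ H.pathSet u k a (u 0), m = 1 := fun m => h.eq_one_of_nonempty hX hb hab
  obtain ⟨m, hm⟩ := Set.nonempty_of_ncard_ne_zero ha
  have hm1 := hM m hm
  subst hm1
  have h4 := ncard_le_of_subset_Icc (p := 1) (q := 1) (S := H.pathSet u k a (u 0)) fun m hm => by
    simp [hM m hm]
  exact Or.inl ⟨hm.2.2, by omega⟩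

/-! ### Comparing the two ends of the path -/

theorem IsLoosePath.isEnd_tail (hP : H.IsLoosePath u (k + 1)) :
    H.IsEnd (fun m => u (2 + m)) k (u 0) (u 1) where
  path := hP.segment (i := 1) (by omega)
  edge := hP.edge 0 (by omega)
  left m hm heq := by
    have := hP.inj _ _ (by omega) (by omega) heq
    omega
  right m hm heq := by
    have := hP.inj _ _ (by omega) (by omega) heq
    omega

theorem IsEnd.exists_reverse (hX : H.IsExtremal n k) (h : H.IsEnd u k a b) :
    ∃ v, H.IsEnd v k (u (2 * k)) (u (2 * k - 1)) ∧ (∀ m, m + 2 ≤ 2 * k → v m = u (2 * k - 2 - m)) ∧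
      v (2 * k - 1) = b ∧ v (2 * k) = a := by
  have hk := h.two_le hX
  have hP := h.path.cons hX.uniform h.edge h.left h.right
  set U : ℕ → α := fun m => if m = 0 then a else if m = 1 then b else u (m - 2) with hU
  have hE := hP.reverse.isEnd_tail
  have hge : ∀ m l, m = l + 2 → U m = u l := by
    rintro _ l rfl
    simp [hU]
  refine ⟨fun m => U (2 * (k + 1) - (2 + m)), ?_, fun m hm => hge _ _ (by omega), ?_, ?_⟩
  · beta_reduce at hE
    rwa [hge (2 * (k + 1) - 0) (2 * k) (by omega), hge (2 * (k + 1) - 1) (2 * k - 1) (by omega)]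
      at hE
  · beta_reduce
    rw [show 2 * (k + 1) - (2 + (2 * k - 1)) = 1 by omega]
    simp [hU]
  · beta_reduce
    rw [show 2 * (k + 1) - (2 + 2 * k) = 0 by omega]
    simp [hU]

/-- Otherwise `{a, b, u p}`, the hyperedge `hz` and the far hyperedge `{u (2 * k), u (2 * k - 1),
a}` form a triangle. -/
theorem IsEnd.notMem_pathSet_of_triple (hX : H.IsExtremal n k) (h : H.IsEnd u k a b)
    (hfar : k - 1 ∈ H.farSet u k a)
    (hz : H.Triple (u (2 * k)) (u (2 * k - 2)) (u (2 * k - 3))) :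
    2 * k - 3 ∉ H.pathSet u k a b ∧ 2 * k - 2 ∉ H.pathSet u k a b := by
  have hk := h.two_le hX
  have hf := hfar.2
  rw [show 2 * (k - 1) + 1 = 2 * k - 1 by omega, show 2 * (k - 1) + 2 = 2 * k by omega] at hf
  have hne : ∀ l m, l ≤ 2 * k → m ≤ 2 * k → l ≠ m → u l ≠ u m := fun l m h1 h2 h3 h4 =>
    h3 (h.path.inj _ _ h1 h2 h4)
  have key : ∀ p q, p < 2 * k - 1 → q < 2 * k - 1 → H.Triple (u p) (u q) (u (2 * k)) →
      ¬ H.Triple a b (u p) := fun p q hp hq hpq hab =>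
    hX.free.false_of_triangle hX.uniform hab hpq hf.rev (h.right _ (by omega)).symm
      (h.right _ (by omega)).symm (hne _ _ (by omega) (by omega) (by omega))
      (h.right _ (by omega)).symm (h.left _ (by omega)) (hne _ _ (by omega) (by omega) (by omega))
  exact ⟨fun hm => key _ _ (by omega) (by omega) hz.rev hm.2.2,
    fun hm => key _ _ (by omega) (by omega) hz.rot hm.2.2⟩

/-- With a nonempty far set the cut count drops below `2 * k`: either `k - 1` is far and two path
indices are lost by `notMem_pathSet_of_triple`, or `k - 1` itself is missing. -/
theorem IsEnd.triple_last (hX : H.IsExtremal n k) (h : H.IsEnd u k a b)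
    (hN : 2 * k ≤ (H.pathSet u k a b).ncard + (H.farSet u k a).ncard)
    (hz : H.Triple (u (2 * k)) (u (2 * k - 2)) (u (2 * k - 3))) :
    H.Triple a b (u (2 * k)) ∧ k - 1 ∉ H.farSet u k a := by
  have hk := h.two_le hX
  rcases exists_least_of_cut (pathSet_subset (H := H) u k a b) (farSet_subset u k a)
    fun _ hi _ hm => h.le_of_mem_farSet hX (Or.inr rfl) hi hm with h0 | ⟨i, hi, hik, hS, hmin⟩
  · rw [h0, Set.ncard_empty] at hN
    have : 2 * k ∈ H.pathSet u k a b := by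
      rw [eq_Icc_of_le_ncard (pathSet_subset u k a b) (by omega)]
      exact ⟨by omega, le_rfl⟩
    exact ⟨this.2.2, by simp [h0]⟩
  exfalso
  have h1 := ncard_le_of_subset_Icc hS
  have h2 := ncard_le_of_subset_Iio fun j hj => ⟨hmin j hj, farSet_subset (H := H) u k a hj⟩
  by_cases hfar : k - 1 ∈ H.farSet u k a
  · have h3 := h.notMem_pathSet_of_triple hX hfar hz
    have hSf : (H.pathSet u k a b).Finite := (Set.finite_Icc _ _).subset hS
    have h4 := Set.ncard_insert_of_notMem h3.1 hSf
    have h5 := Set.ncard_insert_of_notMem (a := 2 * k - 2)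
      (s := insert (2 * k - 3) (H.pathSet u k a b)) (by
        rintro (h6 | h6)
        · omega
        · exact h3.2 h6) (hSf.insert _)
    have h6 := ncard_le_of_subset_Icc (p := 1) (q := 2 * i + 2)
      (S := insert (2 * k - 2) (insert (2 * k - 3) (H.pathSet u k a b))) (by
        rintro m (rfl | rfl | hm)
        · simp only [Set.mem_Icc]
          omega
        · simp only [Set.mem_Icc]
          omega
        · exact hS hm)
    omega
  · have hik' : i ≠ k - 1 := by
      rintro rfl
      exact hfar hi
    have h3 := ncard_le_of_subset_Iio (I := H.farSet u k a) (p := i) (q := k - 1) fun j hj => by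
      have hj1 := hmin j hj
      have hj2 := farSet_subset u k a hj
      have hj3 : j ≠ k - 1 := by
        rintro rfl
        exact hfar hj
      simp only [Set.mem_Iio] at hj2
      omega
    omega

/-- The last hyperedge of a longest linear path has two vertices that form a hyperedge with every
other vertex. -/
theorem IsEnd.triple_of_mem (hX : H.IsExtremal n k) (h : H.IsEnd u k a b) :
    ∀ x ∈ V(H), x ≠ a → x ≠ b → H.Triple a b x := by
  have hk := h.two_le hX
  rcases h.dichotomy hX with ⟨ht, hN⟩ | ⟨-, hfull⟩
  swap
  · exact hfull
  obtain ⟨v, hv, hvm, hvb, hva⟩ := h.exists_reverse hX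
  have hz : H.Triple (v (2 * k)) (v (2 * k - 2)) (v (2 * k - 3)) := by
    rw [hva, hvm _ (by omega), hvm _ (by omega)]
    convert ht using 2 <;> omega
  exfalso
  rcases hv.dichotomy hX with ⟨ht', hN'⟩ | ⟨hfar, hfull⟩
  · rw [hvm 0 (by omega), hvm 1 (by omega), show 2 * k - 2 - 1 = 2 * k - 3 by omega] at ht'
    have h1 := (h.triple_last hX hN ht').1
    -- Seen from the other end, `{a, b, u (2 * k)}` is the far hyperedge of index `k - 1`.
    refine (hv.triple_last hX hN' hz).2 ⟨by omega, ?_⟩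
    rw [show 2 * (k - 1) + 1 = 2 * k - 1 by omega, show 2 * (k - 1) + 2 = 2 * k by omega, hva, hvb]
    exact h1.rev
  · have h1 : ∀ m, 1 ≤ m → m ≤ 2 * k → m ∈ H.pathSet v k (u (2 * k)) (u (2 * k - 1)) :=
      fun m hm hm' => ⟨hm, hm', hfull _ (hv.mem hm') (hv.left _ hm') (hv.right _ hm')⟩
    rcases hfar with hfar | hfar
    · exact (hv.notMem_pathSet_of_triple hX hfar hz).1 (h1 _ (by omega) (by omega))
    · have := (hv.symm.notMem_pathSet_of_triple hX hfar hz).1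
      rw [pathSet_comm] at this
      exact this (h1 _ (by omega) (by omega))

theorem IsEnd.false (hX : H.IsExtremal n k) (h : H.IsEnd u k a b) : False := by
  have hk := h.two_le hX
  have hne : ∀ l m, l ≤ 2 * k → m ≤ 2 * k → l ≠ m → u l ≠ u m := fun l m h1 h2 h3 h4 =>
    h3 (h.path.inj _ _ h1 h2 h4)
  have h1 := h.triple_of_mem hX _ (h.mem (m := 2 * k) le_rfl) (h.left _ le_rfl) (h.right _ le_rfl)
  obtain ⟨v, hv, -⟩ := h.exists_reverse hX
  have h2 := hv.triple_of_mem hX (u 0) (h.mem (by omega)) (hne _ _ (by omega) (by omega) (by omega))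
    (hne _ _ (by omega) (by omega) (by omega))
  -- Since `{a, b, u (2 * k)}` is a hyperedge, `{a, b}` can precede the reversed path, whose other
  -- end pair is `{u 0, u 1}`.
  have hr : H.IsEnd (fun m => u (2 * k - m)) k a b :=
    ⟨h.path.reverse, h1, fun m _ => h.left _ (by omega), fun m _ => h.right _ (by omega)⟩
  obtain ⟨w, hw, -⟩ := hr.exists_reverse hX
  have e1 : 2 * k - 2 * k = 0 := by omega
  have e2 : 2 * k - (2 * k - 1) = 1 := by omega
  simp only [e1, e2] at hw
  have h3 := hw.triple_of_mem hX a h.edge.mem (h.left _ (by omega)).symm (h.left _ (by omega)).symm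
  exact hX.free.false_of_triangle hX.uniform h1 h2 h3 (h.right _ (by omega)).symm
    (h.right _ (by omega)).symm (hne _ _ (by omega) (by omega) (by omega))
    (h.right _ (by omega)).symm (h.left _ (by omega)) (hne _ _ (by omega) (by omega) (by omega))

/-! ### Existence of a longest path -/

theorem IsLoosePath.length_lt (hf : V(H).Finite) (hP : H.IsLoosePath u k) (hk : 1 ≤ k) :
    k < V(H).ncard := by
  have hinj : Set.InjOn u (Set.Iic (2 * k)) := fun x hx y hy => hP.inj x y hx hy
  have h2 : u '' Set.Iic (2 * k) ⊆ V(H) := by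
    rintro _ ⟨m, hm, rfl⟩
    exact hP.mem hk hm
  have h3 := Set.ncard_le_ncard h2 hf
  rw [hinj.ncard_image, ← Finset.coe_Iic, Set.ncard_coe_finset, Nat.card_Iic] at h3
  omega

end Hypergraph

theorem mainTheorem3 {α : Type*} (H : Hypergraph α) (n : ℕ) (hn : 10 ≤ n)
    (hcard : V(H).ncard = n) (hunif : H.IsThreeUniform) (hfree : H.IsLinearCycleFree) :
    ∃ x ∈ V(H), H.degree x ≤ n - 2 := by
  by_contra hcon
  push Not at hcon
  have hfin : V(H).Finite := Set.finite_of_ncard_ne_zero (by omega)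
  have hdeg : ∀ x ∈ V(H), n ≤ H.degree x + 1 := fun x hx => by
    have := hcon x hx
    omega
  obtain ⟨x, hx⟩ : V(H).Nonempty := Set.nonempty_of_ncard_ne_zero (by omega)
  have hedge : ∃ u, H.IsLoosePath u 1 := by
    have hx1 := hdeg x hx
    unfold Hypergraph.degree at hx1
    obtain ⟨e, he, hxe⟩ := Set.nonempty_of_ncard_ne_zero
      (by omega : {e | e ∈ E(H) ∧ x ∈ e}.ncard ≠ 0)
    obtain ⟨y, z, rfl⟩ := hunif.exists_triple he hxe
    exact ⟨_, Hypergraph.Triple.isLoosePath hunif he⟩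
  obtain ⟨k, ⟨u, hu⟩, hmax⟩ : ∃ k, (∃ u, H.IsLoosePath u (k + 1)) ∧ ∀ u, ¬ H.IsLoosePath u (k + 2) := by
    by_contra hc
    push Not at hc
    have hall : ∀ k, ∃ u, H.IsLoosePath u (k + 1) := fun k => by
      induction k with
      | zero => exact hedge
      | succ k ih => exact hc k ih
    obtain ⟨u, hu⟩ := hall n
    have := hu.length_lt hfin (by omega)
    omega
  exact hu.isEnd_tail.false ⟨hunif, hfree, hfin, hcard, hn, hdeg, hmax⟩
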